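/- Cut a rectangular solid along equally spaced grid lines into $L\times M\times N$ solid cubes of side length $\ell>0$. Each cube has its own 8 vertices, so there are $24LMN$ vertex coordinates; each cube is made rigid by 12 edge length constraints $\|v_i-v_j\|^2-\ell^2=0$ and 6 face diagonal length constraints $\|v_i-v_j\|^2-2\ell^2=0$ (one diagonal per face). A link joins two vertices of two different cubes that lie at the same grid point, and imposes the three constraints that the $x$-, $y$- and $z$-coordinates of the two vertices agree. For a finite set of links let $A$ be the rigidity matrix, whose rows are the gradients of all these constraint functions in the undeformed position. The degrees of freedom of the assembly are $24LMN-\operatorname{rank}A$, and the set of links rigidifies the assembly if this number is $6$. Let $\delta_{3D}(L,M,N)$ be the minimum number of links that rigidify the $L\times M\times N$ assembly. Theorem. There are infinitely many triples $(L,M,N)$ of positive integers, not all three equal, with $$\delta_{3D}(L,M,N)=2LMN-2 .$$ Moreover, this equality holds for all $L=2a_l+3b_l$, $M=2a_m+3b_m$, $N=2a_n+3b_n$ with nonnegative integers $a_l,b_l,a_m,b_m,a_n,b_n$ such that $a_l+b_l=a_m+b_m=a_n+b_n\ge 2$; for example, for $(L,M,N)=(20,19,18)$. -/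

import Mathlib

namespace PrismaticAssembly

/-- The cubes of an `L × M × N` prismatic assembly, indexed by their place in the grid. -/
abbrev Cube (L M N : ℕ) : Type := Fin L × Fin M × Fin N

/-- The eight corners of a cube: in each of the three directions the near side `0` or the
far side `1`. -/
abbrev Corner : Type := Fin 3 → Fin 2

/-- The vertices of the assembly. Every cube has its own eight vertices (so several vertices lie at
the same point of space). -/
abbrev Vertex (L M N : ℕ) : Type := Cube L M N × Corner

/-- The coordinates of the assembly: the three coordinates of every vertex, `24 L M N` in all. -/
abbrev Coord (L M N : ℕ) : Type := Vertex L M N × Fin 3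

/-- A configuration: a value for each of the `24 L M N` coordinates. -/
abbrev Config (L M N : ℕ) : Type := Coord L M N → ℝ

variable {L M N : ℕ}

/-- The place of a cube in the grid as a vector of natural numbers. -/
def cubePos (c : Cube L M N) : Fin 3 → ℕ := ![(c.1 : ℕ), (c.2.1 : ℕ), (c.2.2 : ℕ)]

/-- The grid point at which a vertex lies in the undeformed assembly. -/
def gridPoint (v : Vertex L M N) : Fin 3 → ℕ := fun a => cubePos v.1 a + (v.2 a : ℕ)

/-- The undeformed configuration of the assembly of cubes with side length `ℓ`. -/
def refConfig (ℓ : ℝ) (L M N : ℕ) : Config L M N := fun p => ℓ * (gridPoint p.1 p.2 : ℝ)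

/-- The squared distance of two vertices in a configuration. -/
def sqDist (u v : Vertex L M N) (x : Config L M N) : ℝ := ∑ a : Fin 3, (x (u, a) - x (v, a)) ^ 2

/-- The twelve edges of a cube: a corner on the near side in the direction `a`, with `a`. -/
abbrev CubeEdge : Type := {e : Corner × Fin 3 // e.1 e.2 = 0}

/-- The end points of an edge. -/
def CubeEdge.ends (e : CubeEdge) : Corner × Corner :=
  (e.1.1, Function.update e.1.1 e.1.2 1)

/-- The six faces of a cube: the direction `a` of the normal, and the side. -/
abbrev CubeFace : Type := Fin 3 × Fin 2

/-- The two opposite vertices of a face between which the diagonal length constraint is imposed,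
one diagonal for each face: the diagonal whose end points have even coordinate sum. (By Dehn's
theorem the cube becomes infinitesimally rigid whichever diagonal is taken in each face, so the
degrees of freedom do not depend on this choice.) -/
def CubeFace.diagonal (f : CubeFace) : Corner × Corner :=
  (fun b => if b = f.1 then f.2 else if b = f.1 + 1 then 0 else f.2,
   fun b => if b = f.1 then f.2 else if b = f.1 + 1 then 1 else 1 - f.2)

/-- A link may be placed between two vertices of different cubes that lie at the same grid point. -/
def IsLink (p : Vertex L M N × Vertex L M N) : Prop :=
  p.1.1 ≠ p.2.1 ∧ gridPoint p.1 = gridPoint p.2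

variable (L M N) in
/-- A link pattern: a finite set of links. A link is an unordered pair of vertices; it is recorded
as an ordered pair in one (and only one) of the two orders, which fixes the sign of its constraint
functions. -/
structure LinkPattern where
  /-- the links of the pattern -/
  links : Finset (Vertex L M N × Vertex L M N)
  isLink : ∀ p ∈ links, IsLink p
  swap_notMem : ∀ p ∈ links, p.swap ∉ links

namespace LinkPattern

/-- The constraints of the assembly with the link pattern `P`: for each cube twelve edge length
constraints and six diagonal length constraints, and for each link three link constraints. -/
abbrev Constraint (P : LinkPattern L M N) : Type :=
  (Cube L M N × (CubeEdge ⊕ CubeFace)) ⊕ ({p // p ∈ P.links} × Fin 3)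

/-- The constraint functions `g`; admissible configurations satisfy `g = 0`. -/
def constraintFun (ℓ : ℝ) (P : LinkPattern L M N) : P.Constraint → Config L M N → ℝ
  | .inl (c, .inl e), x => sqDist (c, e.ends.1) (c, e.ends.2) x - ℓ ^ 2
  | .inl (c, .inr f), x => sqDist (c, f.diagonal.1) (c, f.diagonal.2) x - 2 * ℓ ^ 2
  | .inr (p, a), x => x (p.1.1, a) - x (p.1.2, a)

/-- The rigidity matrix: the `(18 L M N + 3 n) × 24 L M N` matrix of the partial derivatives of the
constraint functions in the undeformed configuration. -/
noncomputable def rigidityMatrix (ℓ : ℝ) (P : LinkPattern L M N) :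
    Matrix P.Constraint (Coord L M N) ℝ :=
  Matrix.of fun i j => fderiv ℝ (P.constraintFun ℓ i) (refConfig ℓ L M N) (Pi.single j 1)

/-- The infinitesimal degrees of freedom `24 L M N - rank A`. (The rank is at most the number
`24 L M N` of columns, so the subtraction of natural numbers does not truncate.) -/
noncomputable def dof (ℓ : ℝ) (P : LinkPattern L M N) : ℕ :=
  24 * L * M * N - (P.rigidityMatrix ℓ).rank

/-- The link pattern rigidifies the assembly: only the six degrees of freedom of the rigid motions
are left. -/
def Rigidifies (ℓ : ℝ) (P : LinkPattern L M N) : Prop := P.dof ℓ = 6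

end LinkPattern

/-- `δ_3D(L, M, N) = n` for cubes of side length `ℓ`: the number `n` is the minimum of the numbers
of links of the link patterns that rigidify the `L × M × N` prismatic assembly. -/
def IsDelta3D (ℓ : ℝ) (L M N n : ℕ) : Prop :=
  IsLeast {m : ℕ | ∃ P : LinkPattern L M N, P.Rigidifies ℓ ∧ P.links.card = m} n

end PrismaticAssembly

namespace PrismaticAssembly

open scoped Matrix

/-! Lower bound: the cubes contribute 18LMN rows and each link three, so rank 24LMN - 6 needs at
least 2LMN - 2 links.

Upper bound: an infinitesimally rigid cube has six parameters and a joint imposes three equations,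
so each new cube may cost only two joints. A closed ring of n cubes is added to a rigid set by
jointing each cube to the set and to its successor (`IsTight.union_wheel`). The first joint leaves
each cube only an angular velocity, and the ring joints give 3n equations in these 3n unknowns;
joint positions are chosen to make the system nonsingular. Explicit rings of shape 2×2, 2×3, 3×2 and
3×3 tile every p×q layer with p, q ≥ 2 (`attachable`). Starting from one cube and growing in the
three directions in turn, every box with all sides at least 2 is reached (`isTight_box`), which
covers more than the stated family. `IsTight.isDelta3D` turns joints into links and kernel vectors
of the rigidity matrix into motions of the cubes. -/

/-- Places of the infinite grid, used both for the cubes and for the grid points; the cube at `c`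
has the corners `p` with `c ≤ p ≤ c + 1`. -/
abbrev Cell : Type := ℕ × ℕ × ℕ

/-- A place of the grid as a vector of reals. -/
def Cell.toVec (c : Cell) : Fin 3 → ℝ := ![c.1, c.2.1, c.2.2]

/-- The grid point `p` is a corner of the cube at `c`. -/
abbrev IsCornerOf (p c : Cell) : Prop := c ≤ p ∧ p ≤ c + 1

/-- Infinitesimal rigid motions of space: angular velocity and velocity of the origin. -/
abbrev Motion : Type := (Fin 3 → ℝ) × (Fin 3 → ℝ)

/-- The velocity of a grid point under an infinitesimal rigid motion. -/
def Motion.vel (m : Motion) (p : Cell) : Fin 3 → ℝ := m.2 + m.1 ⨯₃ p.toVec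

/-- A finite set of cubes can be made rigid by twice its cardinality minus two joints. A joint
`(c, d, p)` joins the cubes at `c` and `d` at their common corner `p`. -/
def IsTight (S : Finset Cell) : Prop :=
  ∃ J : Finset (Cell × Cell × Cell), J.card + 2 ≤ 2 * S.card ∧
    (∀ j ∈ J, j.1 ∈ S ∧ j.2.1 ∈ S ∧ j.1 ≠ j.2.1 ∧ IsCornerOf j.2.2 j.1 ∧ IsCornerOf j.2.2 j.2.1) ∧
    ∀ m : Cell → Motion, (∀ j ∈ J, (m j.1).vel j.2.2 = (m j.2.1).vel j.2.2) →
      ∀ c ∈ S, ∀ d ∈ S, m c = m d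

lemma isTight_singleton (c : Cell) : IsTight {c} := by
  refine ⟨∅, by simp, by simp, fun m _ a ha b hb => ?_⟩
  rw [Finset.mem_singleton] at ha hb
  rw [ha, hb]

lemma Motion.vel_sub (m m' : Motion) (p : Cell) : (m - m').vel p = m.vel p - m'.vel p := by
  simp only [Motion.vel, Prod.fst_sub, Prod.snd_sub, LinearMap.map_sub, LinearMap.sub_apply]
  abel

lemma Motion.vel_eq_of_vel_eq_zero {m : Motion} {s : Cell} (h : m.vel s = 0) (p : Cell) :
    m.vel p = m.1 ⨯₃ (p.toVec - s.toVec) := by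
  have h2 : m.2 = -(m.1 ⨯₃ s.toVec) := eq_neg_of_add_eq_zero_left h
  rw [Motion.vel, h2, LinearMap.map_sub]
  abel

lemma Cell.toVec_add_sub (o p s : Cell) :
    (o + p).toVec - (o + s).toVec = p.toVec - s.toVec := by
  ext a
  fin_cases a <;> simp [Cell.toVec]

/-- A closed chain of cubes `c i`, the cube `c i` jointed to the cube `b i` at `s i` and to the
cube `c (i + 1)` at `p i`, rigidly extends a set containing the cubes `b i`, provided that the
chain has no infinitesimal motion when the points `s i` are fixed. -/
lemma IsTight.union_wheel {S : Finset Cell} (hS : IsTight S) {n : ℕ} [NeZero n]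
    (b c s p : Fin n → Cell)
    (hc : Function.Injective c) (hb : ∀ i, IsCornerOf (s i) (b i))
    (hs : ∀ i, IsCornerOf (s i) (c i)) (hp : ∀ i, IsCornerOf (p i) (c i))
    (hp' : ∀ i, IsCornerOf (p i) (c (i + 1))) (hne : ∀ i, c i ≠ c (i + 1))
    (hrig : ∀ w : Fin n → Fin 3 → ℝ,
      (∀ i, w i ⨯₃ ((p i).toVec - (s i).toVec) =
        w (i + 1) ⨯₃ ((p i).toVec - (s (i + 1)).toVec)) → ∀ i, w i = 0)
    (o : Cell) (hbS : ∀ i, o + b i ∈ S) (hcS : ∀ i, o + c i ∉ S) :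
    IsTight (S ∪ Finset.univ.image fun i => o + c i) := by
  classical
  obtain ⟨J, hcard, hJ, hm⟩ := hS
  have hcorner : ∀ {p c : Cell}, IsCornerOf p c → IsCornerOf (o + p) (o + c) := fun {p c} h =>
    ⟨add_le_add_right h.1 o, by rw [add_assoc]; exact add_le_add_right h.2 o⟩
  -- Two joints per new cube: one to the old set, one to its successor. Coincidences would only
  -- lower the count.
  refine ⟨J ∪ ((Finset.univ.image fun i => (o + c i, o + b i, o + s i)) ∪
    Finset.univ.image fun i => (o + c i, o + c (i + 1), o + p i)), ?_, ?_, ?_⟩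
  · have h1 : (S ∪ Finset.univ.image fun i => o + c i).card = S.card + n := by
      rw [Finset.card_union_of_disjoint, Finset.card_image_of_injective, Finset.card_univ,
        Fintype.card_fin]
      · exact fun i j h => hc (add_left_cancel h)
      · rw [Finset.disjoint_right]
        intro x hx
        obtain ⟨i, -, rfl⟩ := Finset.mem_image.1 hx
        exact hcS i
    have h2 : ∀ f : Fin n → Cell × Cell × Cell, (Finset.univ.image f).card ≤ n := fun f =>
      Finset.card_image_le.trans (by simp)
    grw [h1, Finset.card_union_le, Finset.card_union_le, h2, h2]
    omega
  · intro j hj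
    have hmem : ∀ i, o + c i ∈ S ∪ Finset.univ.image fun i => o + c i := fun i =>
      Finset.mem_union_right _ (Finset.mem_image_of_mem _ (Finset.mem_univ i))
    simp only [Finset.mem_union (s := J), Finset.mem_union, Finset.mem_image, Finset.mem_univ,
      true_and] at hj
    rcases hj with hj | ⟨i, rfl⟩ | ⟨i, rfl⟩
    · obtain ⟨h1, h2, h3⟩ := hJ j hj
      exact ⟨Finset.mem_union_left _ h1, Finset.mem_union_left _ h2, h3⟩
    · exact ⟨hmem i, Finset.mem_union_left _ (hbS i), fun h => hcS i ((show o + c i = o + b i from h) ▸ hbS i),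
        hcorner (hs i), hcorner (hb i)⟩
    · exact ⟨hmem i, hmem (i + 1), fun h => hne i (add_left_cancel h), hcorner (hp i),
        hcorner (hp' i)⟩
  · intro m hv
    have hconst := hm m fun j hj => hv j (Finset.mem_union_left _ hj)
    let m₀ := m (o + b 0)
    have hS₀ : ∀ x ∈ S, m x = m₀ := fun x hx => hconst x hx _ (hbS 0)
    -- Relative to the old set, each new cube fixes its point `s i`, so only its angular velocity is
    -- unknown.
    have hfix : ∀ i, (m (o + c i) - m₀).vel (o + s i) = 0 := fun i => by
      have := hv (o + c i, o + b i, o + s i) (Finset.mem_union_right _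
        (Finset.mem_union_left _ (Finset.mem_image.2 ⟨i, Finset.mem_univ i, rfl⟩)))
      rw [Motion.vel_sub, sub_eq_zero, ← hS₀ _ (hbS i)]
      exact this
    have hw : ∀ i, (m (o + c i) - m₀).1 = 0 := by
      refine hrig (fun i => (m (o + c i) - m₀).1) fun i => ?_
      have := hv (o + c i, o + c (i + 1), o + p i) (Finset.mem_union_right _
        (Finset.mem_union_right _ (Finset.mem_image.2 ⟨i, Finset.mem_univ i, rfl⟩)))
      rw [← Cell.toVec_add_sub o (p i) (s i), ← Cell.toVec_add_sub o (p i) (s (i + 1)),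
        ← Motion.vel_eq_of_vel_eq_zero (hfix i), ← Motion.vel_eq_of_vel_eq_zero (hfix (i + 1)),
        Motion.vel_sub, Motion.vel_sub]
      exact congrArg (· - _) this
    have hC₀ : ∀ i, m (o + c i) = m₀ := fun i => by
      have h2 := hfix i
      rw [Motion.vel, hw i] at h2
      rw [← sub_eq_zero]
      exact Prod.ext (hw i) (by simpa using h2)
    have hall : ∀ x ∈ S ∪ Finset.univ.image fun i => o + c i, m x = m₀ := by
      intro x hx
      rcases Finset.mem_union.1 hx with hx | hx
      · exact hS₀ x hx
      · obtain ⟨i, -, rfl⟩ := Finset.mem_image.1 hx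
        exact hC₀ i
    intro x hx y hy
    rw [hall x hx, hall y hy]

/-! ### Cyclic symmetry of the grid -/

/-- The cyclic permutation of the coordinates of the grid. -/
def rotate (c : Cell) : Cell := (c.2.1, c.2.2, c.1)

lemma rotate_injective : Function.Injective rotate := by
  rintro ⟨x, y, z⟩ ⟨x', y', z'⟩ h
  simp only [rotate, Prod.mk.injEq] at h
  simp [h]

lemma IsCornerOf.rotate {p c : Cell} (h : IsCornerOf p c) : IsCornerOf (rotate p) (rotate c) :=
  ⟨⟨h.1.2.1, h.1.2.2, h.1.1⟩, ⟨h.2.2.1, h.2.2.2, h.2.1⟩⟩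

lemma IsTight.rotate {S : Finset Cell} (hS : IsTight S) : IsTight (S.image rotate) := by
  classical
  obtain ⟨J, hcard, hJ, hm⟩ := hS
  refine ⟨J.image fun j => (PrismaticAssembly.rotate j.1, PrismaticAssembly.rotate j.2.1,
    PrismaticAssembly.rotate j.2.2), ?_, ?_, ?_⟩
  · rw [Finset.card_image_of_injective S rotate_injective]
    grw [Finset.card_image_le]
    exact hcard
  · intro j hj
    obtain ⟨k, hk, rfl⟩ := Finset.mem_image.1 hj
    obtain ⟨h1, h2, h3, h4, h5⟩ := hJ k hk
    exact ⟨Finset.mem_image_of_mem _ h1, Finset.mem_image_of_mem _ h2,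
      fun h => h3 (rotate_injective h), h4.rotate, h5.rotate⟩
  · intro m hv
    -- `r` undoes `rotate` on vectors. A cyclic permutation is even, so it commutes with the cross
    -- product.
    let r : (Fin 3 → ℝ) → Fin 3 → ℝ := fun v => ![v 2, v 0, v 1]
    have hr : Function.Injective r := fun v w h => by
      have h0 := congrFun h 0
      have h1 := congrFun h 1
      have h2 := congrFun h 2
      ext a
      fin_cases a
      exacts [h1, h2, h0]
    have hvel : ∀ (m : Motion) (p : Cell),
        Motion.vel (r m.1, r m.2) p = r (m.vel (PrismaticAssembly.rotate p)) := fun m p => by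
      ext a
      fin_cases a <;>
        simp [r, Motion.vel, cross_apply, Cell.toVec, PrismaticAssembly.rotate] <;> rfl
    have := hm (fun c => (r (m (PrismaticAssembly.rotate c)).1, r (m (PrismaticAssembly.rotate c)).2))
      fun j hj => by
        rw [hvel, hvel]
        exact congrArg r (hv _ (Finset.mem_image_of_mem _ hj))
    intro c hc d hd
    obtain ⟨c, hcS, rfl⟩ := Finset.mem_image.1 hc
    obtain ⟨d, hdS, rfl⟩ := Finset.mem_image.1 hd
    have h := Prod.ext_iff.1 (this c hcS d hdS)
    exact Prod.ext (hr h.1) (hr h.2)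

/-! ### Boxes and the attachment of layers -/

/-- The cubes of the `a × b × n` assembly. -/
def box (a b n : ℕ) : Finset Cell := Finset.range a ×ˢ Finset.range b ×ˢ Finset.range n

lemma mem_box {a b n : ℕ} {c : Cell} : c ∈ box a b n ↔ c.1 < a ∧ c.2.1 < b ∧ c.2.2 < n := by
  simp [box]

lemma image_rotate_box (a b n : ℕ) : (box a b n).image rotate = box b n a := by
  ext ⟨x, y, z⟩
  simp only [Finset.mem_image, mem_box]
  constructor
  · rintro ⟨⟨u, v, w⟩, h, he⟩
    simp only [rotate, Prod.mk.injEq] at h he ⊢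
    omega
  · intro h
    exact ⟨(z, x, y), ⟨h.2.2, h.1, h.2.1⟩, rfl⟩

/-- The `p × q` plate of cubes at height `o.2.2 + 1` with lowest cube above `o`. -/
def plate (o : Cell) (p q : ℕ) : Finset Cell :=
  Finset.Ico o.1 (o.1 + p) ×ˢ Finset.Ico o.2.1 (o.2.1 + q) ×ˢ {o.2.2 + 1}

lemma mem_plate {o c : Cell} {p q : ℕ} : c ∈ plate o p q ↔
    (o.1 ≤ c.1 ∧ c.1 < o.1 + p) ∧ (o.2.1 ≤ c.2.1 ∧ c.2.1 < o.2.1 + q) ∧ c.2.2 = o.2.2 + 1 := by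
  simp only [plate, Finset.mem_product, Finset.mem_Ico, Finset.mem_singleton]

/-- A `p × q` plate can be put on top of any rigid set of cubes, with two joints for each new
cube. -/
def Attachable (p q : ℕ) : Prop :=
  ∀ (S : Finset Cell) (o : Cell), IsTight S → (∀ i < p, ∀ j < q, o + (i, j, 0) ∈ S) →
    Disjoint S (plate o p q) → IsTight (S ∪ plate o p q)

/-- The two plates are put on one after the other; the second rests on the set already enlarged by
the first. -/
lemma Attachable.add_right {p q q' : ℕ} (h : Attachable p q) (h' : Attachable p q') :
    Attachable p (q + q') := by
  rintro S ⟨x, y, z⟩ hS hb hd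
  have hun : plate (x, y, z) p (q + q') = plate (x, y, z) p q ∪ plate (x, y + q, z) p q' := by
    ext c
    simp only [mem_plate, Finset.mem_union]
    omega
  rw [hun, Finset.disjoint_union_right] at hd
  rw [hun, ← Finset.union_assoc]
  refine h' _ _ (h _ _ hS (fun i hi j hj => hb i hi j (by omega)) hd.1) (fun i hi j hj => ?_) ?_
  · refine Finset.mem_union_left _ ?_
    have := hb i hi (q + j) (by omega)
    simpa [add_assoc] using this
  · refine Finset.disjoint_union_left.2 ⟨hd.2, Finset.disjoint_left.2 fun c => ?_⟩
    simp only [mem_plate]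
    omega

lemma Attachable.add_left {p p' q : ℕ} (h : Attachable p q) (h' : Attachable p' q) :
    Attachable (p + p') q := by
  rintro S ⟨x, y, z⟩ hS hb hd
  have hun : plate (x, y, z) (p + p') q = plate (x, y, z) p q ∪ plate (x + p, y, z) p' q := by
    ext c
    simp only [mem_plate, Finset.mem_union]
    omega
  rw [hun, Finset.disjoint_union_right] at hd
  rw [hun, ← Finset.union_assoc]
  refine h' _ _ (h _ _ hS (fun i hi j hj => hb i (by omega) j hj) hd.1) (fun i hi j hj => ?_) ?_
  · refine Finset.mem_union_left _ ?_
    have := hb (p + i) (by omega) j hj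
    simpa [add_assoc] using this
  · refine Finset.disjoint_union_left.2 ⟨hd.2, Finset.disjoint_left.2 fun c => ?_⟩
    simp only [mem_plate]
    omega

/-- Reduces a plate to finite data: a cyclic order `c` of its cells, joints `s` to the cubes below,
and joints `t` to the next cube of the ring. -/
lemma attachable_of_wheel {p q n : ℕ} [NeZero n] (c : Fin n → ℕ × ℕ)
    (s t : Fin n → Cell) (hc : Function.Injective c)
    (hlt : ∀ i, (c i).1 < p ∧ (c i).2 < q) (hsurj : ∀ i < p, ∀ j < q, ∃ k, c k = (i, j))
    (hb : ∀ i, IsCornerOf (s i) ((c i).1, (c i).2, 0))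
    (hs : ∀ i, IsCornerOf (s i) ((c i).1, (c i).2, 1))
    (ht : ∀ i, IsCornerOf (t i) ((c i).1, (c i).2, 1))
    (ht' : ∀ i, IsCornerOf (t i) ((c (i + 1)).1, (c (i + 1)).2, 1)) (hne : ∀ i, c i ≠ c (i + 1))
    (hrig : ∀ w : Fin n → Fin 3 → ℝ,
      (∀ i, w i ⨯₃ ((t i).toVec - (s i).toVec) =
        w (i + 1) ⨯₃ ((t i).toVec - (s (i + 1)).toVec)) → ∀ i, w i = 0) :
    Attachable p q := by
  rintro S ⟨x, y, z⟩ hS hbS hd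
  have hpl : plate (x, y, z) p q =
      Finset.univ.image fun i => (x, y, z) + ((c i).1, (c i).2, 1) := by
    ext ⟨u, v, w⟩
    simp only [mem_plate, Finset.mem_image, Finset.mem_univ, true_and, Prod.mk_add_mk,
      Prod.mk.injEq]
    constructor
    · rintro ⟨h1, h2, rfl⟩
      obtain ⟨k, hk⟩ := hsurj (u - x) (by omega) (v - y) (by omega)
      refine ⟨k, ?_⟩
      rw [hk]
      omega
    · rintro ⟨k, h1, h2, h3⟩
      have := hlt k
      omega
  rw [hpl] at hd ⊢
  refine hS.union_wheel (fun i => ((c i).1, (c i).2, 0)) (fun i => ((c i).1, (c i).2, 1)) s t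
    ?_ hb hs ht ht' ?_ hrig (x, y, z) (fun i => hbS _ (hlt i).1 _ (hlt i).2) ?_
  · intro i j h
    simp only [Prod.mk.injEq, and_true] at h
    exact hc (Prod.ext h.1 h.2)
  · intro i h
    simp only [Prod.mk.injEq, and_true] at h
    exact hne i (Prod.ext h.1 h.2)
  · intro i hi
    exact Finset.disjoint_left.1 hd hi (Finset.mem_image_of_mem _ (Finset.mem_univ i))

lemma attachable_two_two : Attachable 2 2 := by
  refine attachable_of_wheel (n := 4) ![(0, 0), (1, 0), (1, 1), (0, 1)]
    ![(0, 0, 1), (1, 1, 1), (1, 2, 1), (0, 1, 1)]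
    ![(1, 0, 1), (2, 1, 2), (1, 2, 2), (1, 1, 2)]
    (by decide) (by decide) (by decide) (by decide) (by decide) (by decide) (by decide) (by decide)
    fun w h => ?_
  simp [Fin.forall_fin_succ, funext_iff, cross_apply, Cell.toVec] at h ⊢
  norm_num at h
  and_intros <;> linarith

lemma attachable_two_three : Attachable 2 3 := by
  refine attachable_of_wheel (n := 6) ![(0, 0), (1, 0), (1, 1), (1, 2), (0, 2), (0, 1)]
    ![(1, 0, 1), (2, 1, 1), (2, 2, 1), (2, 3, 1), (0, 2, 1), (1, 1, 1)]
    ![(1, 1, 2), (2, 1, 2), (1, 2, 1), (1, 3, 2), (1, 2, 1), (0, 1, 2)]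
    (by decide) (by decide) (by decide) (by decide) (by decide) (by decide) (by decide) (by decide)
    fun w h => ?_
  simp [Fin.forall_fin_succ, funext_iff, cross_apply, Cell.toVec] at h ⊢
  norm_num at h
  and_intros <;> linarith

lemma attachable_three_two : Attachable 3 2 := by
  refine attachable_of_wheel (n := 6) ![(0, 0), (1, 0), (2, 0), (2, 1), (1, 1), (0, 1)]
    ![(0, 0, 1), (2, 1, 1), (2, 0, 1), (3, 2, 1), (2, 2, 1), (1, 1, 1)]
    ![(1, 0, 1), (2, 0, 2), (2, 1, 2), (2, 1, 1), (1, 2, 2), (1, 1, 2)]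
    (by decide) (by decide) (by decide) (by decide) (by decide) (by decide) (by decide) (by decide)
    fun w h => ?_
  simp [Fin.forall_fin_succ, funext_iff, cross_apply, Cell.toVec] at h ⊢
  norm_num at h
  and_intros <;> linarith

/-- With nine cells a ring of face neighbours is impossible by chessboard parity; the ring here has
one diagonal step, from (0, 2) to (1, 1). -/
lemma attachable_three_three : Attachable 3 3 := by
  refine attachable_of_wheel (n := 9)
    ![(0, 0), (1, 0), (2, 0), (2, 1), (2, 2), (1, 2), (0, 2), (1, 1), (0, 1)]
    ![(0, 0, 1), (2, 0, 1), (2, 1, 1), (3, 2, 1), (2, 2, 1), (1, 3, 1), (0, 3, 1), (2, 1, 1),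
      (1, 2, 1)]
    ![(1, 0, 2), (2, 0, 2), (2, 1, 2), (3, 2, 2), (2, 2, 2), (1, 3, 2), (1, 2, 2), (1, 1, 1),
      (0, 1, 2)]
    (by decide) (by decide) (by decide) (by decide) (by decide) (by decide) (by decide) (by decide)
    fun w h => ?_
  simp [Fin.forall_fin_succ, funext_iff, cross_apply, Cell.toVec] at h ⊢
  norm_num at h
  and_intros <;> linarith

lemma attachable {p q : ℕ} (hp : 2 ≤ p) (hq : 2 ≤ q) : Attachable p q := by
  -- Every integer at least 2 is a sum of 2s and at most one 3.
  have key : ∀ P : ℕ → Prop, P 2 → P 3 → (∀ n, P 2 → P n → P (2 + n)) → ∀ n, 2 ≤ n → P n := by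
    intro P h2 h3 hadd n
    induction n using Nat.strong_induction_on with
    | _ n ih =>
      intro hn
      by_cases h : n < 4
      · interval_cases n
        exacts [h2, h3]
      · obtain ⟨k, rfl⟩ := Nat.exists_eq_add_of_le hn
        exact hadd k h2 (ih k (by omega) (by omega))
  have hq2 := key (Attachable 2) attachable_two_two attachable_two_three
    (fun n h h' => h.add_right h') q hq
  have hq3 := key (Attachable 3) attachable_three_two attachable_three_three
    (fun n h h' => Attachable.add_right attachable_three_two h') q hq
  exact key (Attachable · q) hq2 hq3 (fun n h h' => h.add_left h') p hp

/-! ### Growing all boxes from one cube -/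

/-- The other three cubes form a ring around the cube at the origin, which serves as the base for
all of them. The ring closes diagonally at (1, 1, 0). -/
lemma isTight_box_two_two_one : IsTight (box 2 2 1) := by
  have h := (isTight_singleton 0).union_wheel (n := 3) (fun _ => 0)
    ![(1, 0, 0), (1, 1, 0), (0, 1, 0)] ![(1, 0, 1), (1, 1, 1), (0, 1, 0)]
    ![(2, 1, 1), (1, 2, 1), (1, 1, 0)] (by decide) (by decide) (by decide) (by decide) (by decide)
    (by decide) (fun w h => by
      simp [Fin.forall_fin_succ, funext_iff, cross_apply, Cell.toVec] at h ⊢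
      norm_num at h
      and_intros <;> linarith) 0 (by decide) (by decide)
  convert h using 1
  decide

lemma IsTight.box_add {a b n : ℕ} (ha : 2 ≤ a) (hb : 2 ≤ b) (hn : 1 ≤ n)
    (h : IsTight (box a b n)) (k : ℕ) : IsTight (box a b (n + k)) := by
  induction k with
  | zero => exact h
  | succ k ih =>
    -- A plate lies one level above its base point; `hn` keeps the subtraction from truncating.
    have hun : box a b (n + (k + 1)) = box a b (n + k) ∪ plate (0, 0, n + k - 1) a b := by
      ext c
      simp only [mem_box, mem_plate, Finset.mem_union]
      omega
    rw [hun]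
    refine attachable ha hb _ _ ih (fun i hi j hj => ?_) (Finset.disjoint_left.2 fun c => ?_)
    · simp only [mem_box, Prod.mk_add_mk]
      omega
    · simp only [mem_box, mem_plate]
      omega

/-- Every assembly with at least two cubes in each direction can be made rigid with the number of
joints given by the count of degrees of freedom. -/
theorem isTight_box {a b n : ℕ} (ha : 2 ≤ a) (hb : 2 ≤ b) (hn : 2 ≤ n) : IsTight (box a b n) := by
  obtain ⟨k, rfl⟩ := Nat.exists_eq_add_of_le ha
  obtain ⟨l, rfl⟩ := Nat.exists_eq_add_of_le hb
  obtain ⟨m, rfl⟩ := Nat.exists_eq_add_of_le hn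
  have h1 := isTight_box_two_two_one.box_add le_rfl le_rfl le_rfl (1 + k)
  rw [← add_assoc] at h1
  have h2 := h1.rotate
  rw [image_rotate_box] at h2
  have h3 := (h2.box_add le_rfl ha one_le_two l).rotate
  rw [image_rotate_box] at h3
  exact h3.box_add ha hb one_le_two m

variable {L M N : ℕ}

/-! ### Infinitesimal rigidity of a cube -/

/-- The six diagonals are the edges of the regular tetrahedron on the even corners, which is rigid;
each odd corner is tied to it by three perpendicular edges. Algebraically, the edges equate velocity
components and the diagonals leave six parameters. -/
lemma cube_infinitesimally_rigid (X : Corner → Fin 3 → ℝ)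
    (he : ∀ e : CubeEdge, ∑ a, (((e.ends.1 a : ℕ) : ℝ) - ((e.ends.2 a : ℕ) : ℝ)) *
      (X e.ends.1 a - X e.ends.2 a) = 0)
    (hf : ∀ f : CubeFace, ∑ a, (((f.diagonal.1 a : ℕ) : ℝ) - ((f.diagonal.2 a : ℕ) : ℝ)) *
      (X f.diagonal.1 a - X f.diagonal.2 a) = 0) :
    ∃ m : Motion, ∀ v, X v = m.2 + m.1 ⨯₃ fun a => ((v a : ℕ) : ℝ) := by
  have edge : ∀ (k : Corner) (a : Fin 3), k a = 0 → X k a = X (Function.update k a 1) a := by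
    intro k a hk
    have h := he ⟨(k, a), hk⟩
    simp only [CubeEdge.ends] at h
    rw [Finset.sum_eq_single a (fun b _ hb => by simp [Function.update_of_ne hb]) (by simp)] at h
    simp [hk] at h
    linarith
  have e0 : ∀ i j : Fin 2, X ![0, i, j] 0 = X ![1, i, j] 0 := fun i j => by
    rw [edge ![0, i, j] 0 rfl]; congr 1; ext b; fin_cases b <;> rfl
  have e1 : ∀ i j : Fin 2, X ![i, 0, j] 1 = X ![i, 1, j] 1 := fun i j => by
    rw [edge ![i, 0, j] 1 rfl]; congr 1; ext b; fin_cases b <;> rfl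
  have e2 : ∀ i j : Fin 2, X ![i, j, 0] 2 = X ![i, j, 1] 2 := fun i j => by
    rw [edge ![i, j, 0] 2 rfl]; congr 1; ext b; fin_cases b <;> rfl
  have d0 := hf (0, 0)
  have d1 := hf (0, 1)
  have d2 := hf (1, 0)
  have d3 := hf (1, 1)
  have d4 := hf (2, 0)
  have d5 := hf (2, 1)
  rw [show CubeFace.diagonal (0, 0) = (![0, 0, 0], ![0, 1, 1]) by decide] at d0
  rw [show CubeFace.diagonal (0, 1) = (![1, 0, 1], ![1, 1, 0]) by decide] at d1
  rw [show CubeFace.diagonal (1, 0) = (![0, 0, 0], ![1, 0, 1]) by decide] at d2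
  rw [show CubeFace.diagonal (1, 1) = (![1, 1, 0], ![0, 1, 1]) by decide] at d3
  rw [show CubeFace.diagonal (2, 0) = (![0, 0, 0], ![1, 1, 0]) by decide] at d4
  rw [show CubeFace.diagonal (2, 1) = (![0, 1, 1], ![1, 0, 1]) by decide] at d5
  simp [Fin.sum_univ_three] at d0 d1 d2 d3 d4 d5
  simp only [Fin.forall_fin_two] at e0 e1 e2
  -- The translation is the velocity of corner 0; the angular velocity is read off from the relative
  -- velocities of the corners (0, 0, 1) and (1, 0, 0).
  refine ⟨(![X ![0, 0, 0] 1 - X ![0, 0, 1] 1, X ![0, 0, 1] 0 - X ![0, 0, 0] 0,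
    X ![1, 0, 0] 1 - X ![0, 0, 0] 1],
    ![X ![0, 0, 0] 0, X ![0, 0, 0] 1, X ![0, 0, 0] 2]), ?_⟩
  suffices h : ∀ i j k : Fin 2, X ![i, j, k] = ![X ![0, 0, 0] 0, X ![0, 0, 0] 1, X ![0, 0, 0] 2] +
      ![X ![0, 0, 0] 1 - X ![0, 0, 1] 1, X ![0, 0, 1] 0 - X ![0, 0, 0] 0,
        X ![1, 0, 0] 1 - X ![0, 0, 0] 1] ⨯₃ ![((i : ℕ) : ℝ), ((j : ℕ) : ℝ), ((k : ℕ) : ℝ)] by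
    intro v
    convert h (v 0) (v 1) (v 2) using 2
    · ext a; fin_cases a <;> rfl
    · congr 1; ext a; fin_cases a <;> rfl
  simp [funext_iff, Fin.forall_fin_succ, cross_apply]
  and_intros <;> linarith

/-! ### The rigidity matrix as a derivative -/

lemma LinkPattern.rigidityMatrix_mulVec (ℓ : ℝ) (P : LinkPattern L M N) (y : Config L M N)
    (i : P.Constraint) :
    (P.rigidityMatrix ℓ *ᵥ y) i = fderiv ℝ (P.constraintFun ℓ i) (refConfig ℓ L M N) y := by
  rw [← ContinuousLinearMap.coe_coe, LinearMap.pi_apply_eq_sum_univ]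
  refine Finset.sum_congr rfl fun j _ => ?_
  rw [smul_eq_mul, mul_comm]
  have h : (fun k => if j = k then 1 else 0 : Config L M N) = Pi.single j 1 := by
    ext k
    simp [Pi.single_apply, eq_comm]
  rw [h]
  rfl

lemma fderiv_sqDist_apply (u v : Vertex L M N) (x y : Config L M N) (r : ℝ) :
    fderiv ℝ (fun x => sqDist u v x - r) x y =
      ∑ a, 2 * (x (u, a) - x (v, a)) * (y (u, a) - y (v, a)) := by
  have h : HasFDerivAt (fun x : Config L M N => sqDist u v x - r) _ x :=
    (HasFDerivAt.fun_sum (u := Finset.univ) fun a _ =>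
      (((hasFDerivAt_apply (𝕜 := ℝ) (u, a) x).sub (hasFDerivAt_apply (v, a) x)).pow 2)).sub_const r
  rw [h.fderiv]
  simp

lemma refConfig_sub (ℓ : ℝ) (c : Cube L M N) (v w : Corner) (a : Fin 3) :
    refConfig ℓ L M N ((c, v), a) - refConfig ℓ L M N ((c, w), a) =
      ℓ * (((v a : ℕ) : ℝ) - ((w a : ℕ) : ℝ)) := by
  simp only [refConfig, gridPoint]
  push_cast
  ring

lemma sum_eq_zero_of_fderiv_sqDist_eq_zero {ℓ r : ℝ} (hℓ : ℓ ≠ 0) {c : Cube L M N} {v w : Corner}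
    {y : Config L M N}
    (h : fderiv ℝ (fun x => sqDist (c, v) (c, w) x - r) (refConfig ℓ L M N) y = 0) :
    ∑ a, (((v a : ℕ) : ℝ) - ((w a : ℕ) : ℝ)) * (y ((c, v), a) - y ((c, w), a)) = 0 := by
  rw [fderiv_sqDist_apply] at h
  simp only [refConfig_sub] at h
  have h2 : (2 * ℓ) * ∑ a, (((v a : ℕ) : ℝ) - ((w a : ℕ) : ℝ)) *
      (y ((c, v), a) - y ((c, w), a)) = 0 := by
    rw [← h, Finset.mul_sum]
    exact Finset.sum_congr rfl fun a _ => by ring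
  exact (mul_eq_zero.1 h2).resolve_left (by simpa using hℓ)

lemma LinkPattern.link_eq_of_mulVec_eq_zero {ℓ : ℝ} {P : LinkPattern L M N} {y : Config L M N}
    (h : P.rigidityMatrix ℓ *ᵥ y = 0) {p : Vertex L M N × Vertex L M N} (hp : p ∈ P.links)
    (a : Fin 3) : y (p.1, a) = y (p.2, a) := by
  have h1 := congrFun h (.inr (⟨p, hp⟩, a))
  rw [P.rigidityMatrix_mulVec] at h1
  have h2 : HasFDerivAt (P.constraintFun ℓ (.inr (⟨p, hp⟩, a))) _ (refConfig ℓ L M N) :=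
    (hasFDerivAt_apply (𝕜 := ℝ) (p.1, a) (refConfig ℓ L M N)).sub (hasFDerivAt_apply (p.2, a) _)
  rw [h2.fderiv] at h1
  simpa [sub_eq_zero] using h1

/-! ### From cells to cubes -/

/-- The place of a cube in the infinite grid. -/
def cellOf (c : Cube L M N) : Cell := (c.1, c.2.1, c.2.2)

lemma cellOf_injective : Function.Injective (cellOf (L := L) (M := M) (N := N)) := by
  rintro ⟨i, j, k⟩ ⟨i', j', k'⟩ h
  simp only [cellOf, Prod.mk.injEq, Fin.val_inj] at h
  simp [h]

lemma cellOf_mem_box (c : Cube L M N) : cellOf c ∈ box L M N :=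
  mem_box.2 ⟨c.1.2, c.2.1.2, c.2.2.2⟩

/-- The grid point of a vertex as a place of the infinite grid. -/
def gridCell (u : Vertex L M N) : Cell := (gridPoint u 0, gridPoint u 1, gridPoint u 2)

lemma gridPoint_eq_iff {u v : Vertex L M N} :
    gridPoint u = gridPoint v ↔ gridCell u = gridCell v := by
  simp [gridCell, funext_iff, Fin.forall_fin_succ]

lemma gridCell_toVec (c : Cube L M N) (v : Corner) :
    (gridCell (c, v)).toVec = (cellOf c).toVec + fun a => ((v a : ℕ) : ℝ) := by
  ext a
  fin_cases a <;> simp [Cell.toVec, gridCell, cellOf, gridPoint, cubePos]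

lemma exists_vertex {c p : Cell} (hc : c ∈ box L M N) (hp : IsCornerOf p c) :
    ∃ u : Vertex L M N, cellOf u.1 = c ∧ gridCell u = p := by
  obtain ⟨x, y, z⟩ := c
  obtain ⟨x', y', z'⟩ := p
  rw [mem_box] at hc
  obtain ⟨⟨h1, h2, h3⟩, ⟨h4, h5, h6⟩⟩ := hp
  simp only [Prod.fst_add, Prod.snd_add, Prod.fst_one, Prod.snd_one] at h1 h2 h3 h4 h5 h6
  refine ⟨((⟨x, hc.1⟩, ⟨y, hc.2.1⟩, ⟨z, hc.2.2⟩), ![⟨x' - x, by omega⟩, ⟨y' - y, by omega⟩,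
    ⟨z' - z, by omega⟩]), rfl, ?_⟩
  simp [gridCell, gridPoint, cubePos]
  omega

lemma exists_motion_of_mulVec_eq_zero {ℓ : ℝ} (hℓ : ℓ ≠ 0) {P : LinkPattern L M N}
    {y : Config L M N} (h : P.rigidityMatrix ℓ *ᵥ y = 0) :
    ∃ m : Cell → Motion, ∀ u a, y (u, a) = (m (cellOf u.1)).vel (gridCell u) a := by
  have hcube : ∀ c : Cube L M N, ∃ m : Motion, ∀ v a, y ((c, v), a) = m.vel (gridCell (c, v)) a := by
    intro c
    obtain ⟨m, hm⟩ := cube_infinitesimally_rigid (fun v a => y ((c, v), a))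
      (fun e => by
        have h1 := congrFun h (.inl (c, .inl e))
        rw [P.rigidityMatrix_mulVec] at h1
        exact sum_eq_zero_of_fderiv_sqDist_eq_zero hℓ h1)
      (fun f => by
        have h1 := congrFun h (.inl (c, .inr f))
        rw [P.rigidityMatrix_mulVec] at h1
        exact sum_eq_zero_of_fderiv_sqDist_eq_zero hℓ h1)
    -- The motion is rebased from the near corner of the cube to the common origin.
    refine ⟨(m.1, m.2 - m.1 ⨯₃ (cellOf c).toVec), fun v a => ?_⟩
    rw [congrFun (hm v) a, Motion.vel, gridCell_toVec, LinearMap.map_add]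
    simp only [Pi.add_apply, Pi.sub_apply]
    ring
  choose m hm using hcube
  refine ⟨Function.extend cellOf m 0, fun u a => ?_⟩
  rw [cellOf_injective.extend_apply]
  exact hm u.1 u.2 a

/-- The velocities of all vertices under a rigid motion of the whole assembly. -/
def rigidVelocity (L M N : ℕ) : Motion →ₗ[ℝ] Config L M N where
  toFun m p := m.vel (gridCell p.1) p.2
  map_add' m m' := by
    ext p
    simp [Motion.vel]
    ring
  map_smul' r m := by
    ext p
    simp [Motion.vel, mul_add]

/-! ### Counting degrees of freedom -/

lemma card_coord : Fintype.card (Coord L M N) = 24 * L * M * N := by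
  simp
  ring

lemma LinkPattern.card_constraint (P : LinkPattern L M N) :
    Fintype.card P.Constraint = 18 * L * M * N + 3 * P.links.card := by
  have h : Fintype.card (CubeEdge ⊕ CubeFace) = 18 := by decide
  rw [Fintype.card_sum, Fintype.card_prod, h]
  simp
  ring

lemma LinkPattern.rank_le (ℓ : ℝ) (P : LinkPattern L M N) :
    (P.rigidityMatrix ℓ).rank ≤ 18 * L * M * N + 3 * P.links.card :=
  (Matrix.rank_le_card_height _).trans_eq P.card_constraint

lemma LinkPattern.Rigidifies.le_card {ℓ : ℝ} {P : LinkPattern L M N} (h : P.Rigidifies ℓ) :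
    2 * L * M * N - 2 ≤ P.links.card := by
  have h1 := P.rank_le ℓ
  rw [LinkPattern.Rigidifies, LinkPattern.dof] at h
  simp only [mul_assoc] at *
  omega

theorem IsTight.isDelta3D {ℓ : ℝ} (hℓ : ℓ ≠ 0) (h : IsTight (box L M N)) :
    IsDelta3D ℓ L M N (2 * L * M * N - 2) := by
  classical
  obtain ⟨J, hcard, hJ, hm⟩ := h
  -- Ordering each pair by the encoding of its cubes ensures that no link occurs in both orders.
  have hex : ∀ j ∈ J, ∃ q : Vertex L M N × Vertex L M N, IsLink q ∧
      Encodable.encode q.1.1 < Encodable.encode q.2.1 ∧ gridCell q.1 = j.2.2 ∧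
      (cellOf q.1.1 = j.1 ∧ cellOf q.2.1 = j.2.1 ∨ cellOf q.1.1 = j.2.1 ∧ cellOf q.2.1 = j.1) := by
    intro j hj
    obtain ⟨h1, h2, h3, h4, h5⟩ := hJ j hj
    obtain ⟨u, hu, hu'⟩ := exists_vertex h1 h4
    obtain ⟨v, hv, hv'⟩ := exists_vertex h2 h5
    have hne : u.1 ≠ v.1 := fun he => h3 (by rw [← hu, ← hv, he])
    have hg : gridPoint u = gridPoint v := gridPoint_eq_iff.2 (hu'.trans hv'.symm)
    rcases lt_or_gt_of_ne (Encodable.encode_injective.ne hne) with hlt | hlt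
    · exact ⟨(u, v), ⟨hne, hg⟩, hlt, hu', .inl ⟨hu, hv⟩⟩
    · exact ⟨(v, u), ⟨hne.symm, hg.symm⟩, hlt, hv', .inr ⟨hv, hu⟩⟩
  choose F hF using hex
  let P : LinkPattern L M N :=
    { links := J.attach.image fun j => F j.1 j.2
      isLink := fun p hp => by
        obtain ⟨j, -, rfl⟩ := Finset.mem_image.1 hp
        exact (hF j.1 j.2).1
      swap_notMem := fun p hp hp' => by
        obtain ⟨j, -, rfl⟩ := Finset.mem_image.1 hp
        obtain ⟨k, -, hk⟩ := Finset.mem_image.1 hp'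
        have h1 := (hF j.1 j.2).2.1
        have h2 := (hF k.1 k.2).2.1
        rw [hk] at h2
        exact lt_asymm h1 h2 }
  have hPcard : P.links.card ≤ J.card := by
    simpa using Finset.card_image_le (s := J.attach) (f := fun j => F j.1 j.2)
  have hbox : (box L M N).card = L * (M * N) := by simp [box]
  have hker : LinearMap.ker (P.rigidityMatrix ℓ).mulVecLin ≤
      LinearMap.range (rigidVelocity L M N) := by
    intro y hy
    have hy' : P.rigidityMatrix ℓ *ᵥ y = 0 := hy
    obtain ⟨m, hmy⟩ := exists_motion_of_mulVec_eq_zero hℓ hy'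
    have hconst := hm m fun j hj => by
      have hl := (hF j hj).1
      have hlink : ∀ a, y ((F j hj).1, a) = y ((F j hj).2, a) :=
        P.link_eq_of_mulVec_eq_zero hy'
          (Finset.mem_image.2 ⟨⟨j, hj⟩, Finset.mem_attach _ _, rfl⟩)
      simp only [hmy, ← gridPoint_eq_iff.1 hl.2, (hF j hj).2.2.1] at hlink
      ext a
      rcases (hF j hj).2.2.2 with ⟨h1, h2⟩ | ⟨h1, h2⟩
      · simpa only [h1, h2] using hlink a
      · simpa only [h1, h2] using (hlink a).symm
    -- The bound `J.card + 2 ≤ 2 * S.card` in `IsTight` excludes the empty set.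
    have hpos : 0 < (box L M N).card := by omega
    obtain ⟨c, hc⟩ := Finset.card_pos.1 hpos
    refine ⟨m c, ?_⟩
    ext p
    rw [hmy p.1 p.2, ← hconst c hc _ (cellOf_mem_box p.1.1)]
    rfl
  have hfin : Module.finrank ℝ (LinearMap.ker (P.rigidityMatrix ℓ).mulVecLin) ≤ 6 := by
    refine (Submodule.finrank_mono hker).trans ((LinearMap.finrank_range_le _).trans ?_)
    simp
  have hsum := LinearMap.finrank_range_add_finrank_ker (P.rigidityMatrix ℓ).mulVecLin
  rw [Module.finrank_fintype_fun_eq_card, card_coord] at hsum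
  change (P.rigidityMatrix ℓ).rank + _ = _ at hsum
  have hrank := P.rank_le ℓ
  -- The kernel bound gives rank at least 24LMN - 6 and the row count gives at most that, so it need
  -- not be checked that rigid motions form a six-dimensional part of the kernel.
  have hrig : P.Rigidifies ℓ := by
    rw [LinkPattern.Rigidifies, LinkPattern.dof]
    simp only [mul_assoc] at *
    omega
  refine ⟨⟨P, hrig, le_antisymm ?_ hrig.le_card⟩, fun n ⟨Q, hQ, hn⟩ => hn ▸ hQ.le_card⟩
  simp only [mul_assoc]
  omega

theorem isDelta3D_of_two_le {ℓ : ℝ} (hℓ : ℓ ≠ 0) (hL : 2 ≤ L) (hM : 2 ≤ M) (hN : 2 ≤ N) :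
    IsDelta3D ℓ L M N (2 * L * M * N - 2) :=
  (isTight_box hL hM hN).isDelta3D hℓ

end PrismaticAssembly

theorem theorem2 (ℓ : ℝ) (hℓ : 0 < ℓ) :
    {t : ℕ × ℕ × ℕ | 0 < t.1 ∧ 0 < t.2.1 ∧ 0 < t.2.2 ∧ ¬ (t.1 = t.2.1 ∧ t.2.1 = t.2.2) ∧
      PrismaticAssembly.IsDelta3D ℓ t.1 t.2.1 t.2.2 (2 * t.1 * t.2.1 * t.2.2 - 2)}.Infinite ∧
    ∀ al bl am bm an bn L M N : ℕ,
      al + bl = am + bm → am + bm = an + bn → 2 ≤ an + bn →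
      L = 2 * al + 3 * bl → M = 2 * am + 3 * bm → N = 2 * an + 3 * bn →
      PrismaticAssembly.IsDelta3D ℓ L M N (2 * L * M * N - 2) := by
  refine ⟨Set.infinite_of_injective_forall_mem (f := fun n : ℕ => (n + 2, n + 2, n + 3)) ?_ ?_, ?_⟩
  · intro a b h
    simpa using h
  · intro n
    exact ⟨by simp, by simp, by simp, by simp,
      PrismaticAssembly.isDelta3D_of_two_le hℓ.ne' (by simp) (by simp) (by simp)⟩
  · intro al bl am bm an bn L M N h1 h2 h3 hL hM hN
    -- Each side is at least twice the common sum, hence at least 4.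
    exact PrismaticAssembly.isDelta3D_of_two_le hℓ.ne' (by omega) (by omega) (by omega)
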